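/- A dendrite is a nondegenerate (i.e. having more than one point) locally connected continuum (compact connected metrizable space) that contains no Jordan curve, i.e. no homeomorphic copy of the circle. An arc $[a,b]$ in a space $X$ is the image of a homeomorphic embedding of $[0,1]$ into $X$ taking $0$ to $a$ and $1$ to $b$, and $(a,b)=[a,b]\setminus\{a,b\}$. Let $f:X\to X$ be a continuous self-map of a dendrite $X$. A point $b\in X$ is called a recurrent point of arc type if there exist an arc $[a,b]\subset X$ and integers $0\le n_0<n_1<n_2<\dots$ such that $f^{n_k}(b)\in(a,b)$ for every $k$ and $f^{n_k}(b)\to b$ as $k\to\infty$. Theorem 1.6. Every recurrent point of arc type of $f$ belongs to the closure of the set of all periodic points of $f$. -/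

import Mathlib

open Filter Topology

/-- A dendrite: a nondegenerate, locally connected, (metrizable) continuum that contains no
Jordan curve, i.e. no homeomorphic copy of the circle. -/
structure IsDendrite (X : Type*) [TopologicalSpace X] : Prop where
  metrizable : TopologicalSpace.MetrizableSpace X
  compact : CompactSpace X
  connected : ConnectedSpace X
  nondegenerate : Nontrivial X
  locallyConnected : LocallyConnectedSpace X
  no_jordan_curve : ¬ ∃ g : Circle → X, IsEmbedding g

/-- `γ` parametrizes an arc `[a, b]` in `X`: it is a homeomorphism of `[0, 1]` onto its image,
and it maps `0` to `a` and `1` to `b`. -/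
structure IsArcParam {X : Type*} [TopologicalSpace X] (γ : unitInterval → X) (a b : X) :
    Prop where
  embedding : IsEmbedding γ
  left : γ 0 = a
  right : γ 1 = b

/-- The open arc `(a, b)`: the arc `[a, b]` parametrized by `γ`, without its endpoints. -/
def openArc {X : Type*} (γ : unitInterval → X) : Set X :=
  γ '' Set.Ioo 0 1

/-- `b` is a limit point of `x` of arc type: for some arc `[a, b]` in `X`, there is a sequence of
iterates `f^{n_k}(x)`, `n_0 < n_1 < ...`, that lie in `(a, b)` and converge to `b`. -/
def IsLimitPtOfArcType {X : Type*} [TopologicalSpace X] (f : X → X) (x b : X) : Prop :=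
  ∃ (a : X) (γ : unitInterval → X), IsArcParam γ a b ∧
    ∃ n : ℕ → ℕ, StrictMono n ∧ (∀ k, f^[n k] x ∈ openArc γ) ∧
      Tendsto (fun k => f^[n k] x) atTop (𝓝 b)

/-- `b` is a recurrent point of arc type: a limit point of itself, of arc type. -/
def IsRecurrentPtOfArcType {X : Type*} [TopologicalSpace X] (f : X → X) (b : X) : Prop :=
  IsLimitPtOfArcType f b b

/-! Call a point between `u` and `v` if it lies in `side u v ∩ side v u`: on the same side of `u` as
`v` and of `v` as `u`. A continuous map that moves `u` towards `v` and `v` towards `u` fixes a point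
between them (`exists_fixedPoint_between`). Consequently, if no point at `p` or between `p` and `f
p` is periodic, the forward orbit of `p` never leaves the side of `p` containing `f p`
(`periodic_or_iterate_mem_side`).

Given a neighbourhood `N` of `b`, take a return `y = f^[n k] b` so close to `b` that all points
between `y` and `b` lie in `N`, then a later return `f^[n j] b` on the arc strictly between `y` and
`b`. Put `g = f^[n k]` and `h = f^[n j - n k]`, so that `g` moves `b` to `y` and `h` moves `y`
towards `b`. Unless a periodic point already appears in `N`, all `g`-iterates of `b` stay on the
side of `y`, and all `h`-iterates of `y` stay on the side of `b`. A common iterate of `g` and `h`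
then moves `b` and `y` towards each other and has a fixed point between them.

This rests on classical facts proved here: a locally connected compact metric space is locally path
connected, paths contain arcs, and without Jordan curves arcs are unique, so that interior points of
an arc separate its ends. -/

/-! ### Local path connectedness of compact, locally connected metric spaces. -/

/-- In a compact metric space that is locally connected, nearby points lie in small connected
sets, uniformly. -/
theorem exists_uniform_preconnected {X : Type*} [MetricSpace X] [CompactSpace X]
    [LocallyConnectedSpace X] {ε : ℝ} (hε : 0 < ε) :
    ∃ δ > 0, ∀ x y : X, dist x y < δ →
      ∃ A : Set X, IsPreconnected A ∧ x ∈ A ∧ y ∈ A ∧ A ⊆ Metric.ball x ε := by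
  let c : X → Set X := fun z => connectedComponentIn (Metric.ball z (ε / 2)) z
  have hc : ∀ z, IsOpen (c z) := fun z => Metric.isOpen_ball.connectedComponentIn
  have hz : ∀ z, z ∈ c z := fun z =>
    mem_connectedComponentIn (Metric.mem_ball_self (half_pos hε))
  obtain ⟨δ, hδ, h⟩ := lebesgue_number_lemma_of_metric isCompact_univ hc
    (fun z _ => Set.mem_iUnion.2 ⟨z, hz z⟩)
  refine ⟨δ, hδ, fun x y hxy => ?_⟩
  obtain ⟨z, hz⟩ := h x trivial
  have hx : x ∈ c z := hz (Metric.mem_ball_self hδ)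
  refine ⟨c z, isPreconnected_connectedComponentIn, hx,
    hz (by rwa [Metric.mem_ball, dist_comm]), fun w hw => ?_⟩
  have h1 := connectedComponentIn_subset _ _ hx
  have h2 := connectedComponentIn_subset _ _ hw
  rw [Metric.mem_ball] at h1 h2 ⊢
  linarith [dist_triangle_right w x z]

/-- A path in `E` that is a concatenation of segments between points of `X` (mapped to `E` by
`φ`) at distance less than `δ`. -/
inductive IsChainPath {X E : Type*} [MetricSpace X] [NormedAddCommGroup E] [NormedSpace ℝ E]
    (φ : X → E) (δ : ℝ) : ∀ {x y : X}, Path (φ x) (φ y) → Prop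
  | segment (x y : X) (h : dist x y < δ) : IsChainPath φ δ (Path.segment (φ x) (φ y))
  | trans {x y z : X} (p : Path (φ x) (φ y)) (q : Path (φ y) (φ z)) :
      IsChainPath φ δ p → IsChainPath φ δ q → IsChainPath φ δ (p.trans q)

theorem Path.trans_mem {E : Type*} [TopologicalSpace E] {x y z : E} {p : Path x y} {q : Path y z}
    {s : Set E} (hp : ∀ t, p t ∈ s) (hq : ∀ t, q t ∈ s) (t : unitInterval) :
    (p.trans q) t ∈ s := by
  rw [Path.trans_apply]
  split_ifs
  · exact hp _
  · exact hq _

theorem Path.segment_mem_ball {E : Type*} [NormedAddCommGroup E] [NormedSpace ℝ E]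
    {x y z : E} {ε : ℝ} (hx : x ∈ Metric.ball z ε) (hy : y ∈ Metric.ball z ε) (t : unitInterval) :
    Path.segment x y t ∈ Metric.ball z ε :=
  (convex_ball z ε).segment_subset hx hy
    (by rw [← Path.range_segment]; exact Set.mem_range_self t)

section Chain

variable {X E : Type*} [MetricSpace X] [NormedAddCommGroup E] [NormedSpace ℝ E] {φ : X → E}

/-- Being joined by fine chains inside the ball is a transitive relation holding between nearby
points of `A`, so connectedness of `A` extends it to all pairs; convexity of the ball keeps the
segments inside. -/
theorem exists_isChainPath (hφ : Isometry φ) {A : Set X} (hA : IsPreconnected A) {x y : X}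
    (hx : x ∈ A) (hy : y ∈ A) {ε δ : ℝ} (hδ : 0 < δ) (hAε : A ⊆ Metric.ball x ε) :
    ∃ p : Path (φ x) (φ y), IsChainPath φ δ p ∧ ∀ t, p t ∈ Metric.ball (φ x) ε := by
  have hmem : ∀ u ∈ A, φ u ∈ Metric.ball (φ x) ε := fun u hu => by
    rw [Metric.mem_ball, hφ.dist_eq]; exact hAε hu
  refine hA.induction₂' (fun u v => ∃ p : Path (φ u) (φ v), IsChainPath φ δ p ∧
    ∀ t, p t ∈ Metric.ball (φ x) ε) (fun u hu => ?_) ?_ hx hy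
  · filter_upwards [mem_nhdsWithin_of_mem_nhds (Metric.ball_mem_nhds u hδ),
      self_mem_nhdsWithin] with v hv hvA
    exact ⟨⟨_, .segment u v (by rwa [dist_comm]),
        Path.segment_mem_ball (hmem u hu) (hmem v hvA)⟩,
      ⟨_, .segment v u hv, Path.segment_mem_ball (hmem v hvA) (hmem u hu)⟩⟩
  · rintro u v w - - - ⟨p, hp, hp'⟩ ⟨q, hq, hq'⟩
    exact ⟨_, .trans p q hp hq, Path.trans_mem hp' hq'⟩

/-- Each segment is replaced by a finer chain on the same time interval, so the error is the one of
a single segment and does not accumulate along the chain. -/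
theorem IsChainPath.refine {ε δ δ' : ℝ} (hφ : Isometry φ)
    (h : ∀ x y : X, dist x y < δ →
      ∃ q : Path (φ x) (φ y), IsChainPath φ δ' q ∧ ∀ t, q t ∈ Metric.ball (φ x) ε)
    {x y : X} {p : Path (φ x) (φ y)} (hp : IsChainPath φ δ p) :
    ∃ q : Path (φ x) (φ y), IsChainPath φ δ' q ∧ ∀ t, dist (p t) (q t) ≤ δ + ε := by
  induction hp with
  | segment x y hxy =>
    obtain ⟨q, hq, hq'⟩ := h x y hxy
    refine ⟨q, hq, fun t => ?_⟩
    have h1 : Path.segment (φ x) (φ y) t ∈ Metric.ball (φ x) δ :=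
      Path.segment_mem_ball (Metric.mem_ball_self (dist_nonneg.trans_lt hxy))
        (by rwa [Metric.mem_ball, hφ.dist_eq, dist_comm]) t
    have h2 := hq' t
    rw [Metric.mem_ball] at h1 h2
    linarith [dist_triangle_right (Path.segment (φ x) (φ y) t) (q t) (φ x)]
  | trans p q _ _ ihp ihq =>
    obtain ⟨p', hp, hp'⟩ := ihp
    obtain ⟨q', hq, hq'⟩ := ihq
    refine ⟨_, .trans p' q' hp hq, fun t => ?_⟩
    rw [Path.trans_apply, Path.trans_apply]
    split_ifs
    · exact hp' _
    · exact hq' _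

theorem IsChainPath.exists_dist_lt {δ : ℝ} (hφ : Isometry φ) {x y : X} {p : Path (φ x) (φ y)}
    (hp : IsChainPath φ δ p) (t : unitInterval) : ∃ z, dist (p t) (φ z) < δ := by
  induction hp generalizing t with
  | segment x y hxy =>
    exact ⟨x, Path.segment_mem_ball (Metric.mem_ball_self (dist_nonneg.trans_lt hxy))
        (by rwa [Metric.mem_ball, hφ.dist_eq, dist_comm]) t⟩
  | trans p q _ _ ihp ihq =>
    rw [Path.trans_apply]
    split_ifs
    · exact ihp _
    · exact ihq _

end Chain

/-- The Kuratowski embedding supplies straight segments in a complete normed space. Successive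
refinements converge uniformly, and the limit lies in the image of `X` because that image is closed
and the chain steps shrink to zero. -/
theorem exists_path_of_dist_lt {X : Type*} [MetricSpace X] [CompactSpace X]
    [LocallyConnectedSpace X] {ε : ℝ} (hε : 0 < ε) :
    ∃ δ > 0, ∀ x y : X, dist x y < δ → ∃ p : Path x y, ∀ t, dist (p t) x ≤ ε := by
  let φ := kuratowskiEmbedding X
  have hφ : Isometry φ := kuratowskiEmbedding.isometry X
  -- As `δ k ≤ e k`, the `k`-th refinement moves points by at most `ε / 4 * (1 / 2) ^ k`, in total
  -- `ε / 2`; the initial segment adds at most `ε / 8`.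
  let e : ℕ → ℝ := fun k => ε / 8 * (1 / 2) ^ k
  have he : ∀ k, 0 < e k := fun k => by positivity
  choose δ₀ hδ₀ H₀ using fun k => exists_uniform_preconnected (X := X) (he k)
  let δ : ℕ → ℝ := fun k => min (δ₀ k) (e k)
  have hδ : ∀ k, 0 < δ k := fun k => lt_min (hδ₀ k) (he k)
  have H : ∀ k, ∀ x y : X, dist x y < δ k → ∃ q : Path (φ x) (φ y),
      IsChainPath φ (δ (k + 1)) q ∧ ∀ t, q t ∈ Metric.ball (φ x) (e k) := fun k x y hxy => by
    obtain ⟨A, hA, hx, hy, hAx⟩ := H₀ k x y (hxy.trans_le (min_le_left _ _))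
    exact exists_isChainPath hφ hA hx hy (hδ _) hAx
  refine ⟨δ 0, hδ 0, fun x y hxy => ?_⟩
  let step : ∀ k, {p : Path (φ x) (φ y) // IsChainPath φ (δ k) p} →
      {p : Path (φ x) (φ y) // IsChainPath φ (δ (k + 1)) p} := fun k p =>
    ⟨(p.2.refine hφ (H k)).choose, (p.2.refine hφ (H k)).choose_spec.1⟩
  have hstep : ∀ k p t, dist (p.1 t) ((step k p).1 t) ≤ δ k + e k := fun k p t =>
    (p.2.refine hφ (H k)).choose_spec.2 t
  let P : ∀ k, {p : Path (φ x) (φ y) // IsChainPath φ (δ k) p} := fun k =>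
    Nat.rec ⟨_, .segment x y hxy⟩ step k
  have hP : ∀ k t, dist ((P k).1 t) ((P (k + 1)).1 t) ≤ ε / 4 * (1 / 2) ^ k := fun k t => by
    have h1 := hstep k (P k) t
    have h2 : δ k ≤ e k := min_le_right _ _
    change dist ((P k).1 t) ((step k (P k)).1 t) ≤ _
    refine h1.trans ?_
    simp only [e] at h2 ⊢
    linarith
  let Q : ℕ → C(unitInterval, lp (fun _ : ℕ => ℝ) ⊤) := fun k => (P k).1.toContinuousMap
  have hQ : ∀ k, dist (Q k) (Q (k + 1)) ≤ ε / 4 * (1 / 2) ^ k := fun k =>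
    (ContinuousMap.dist_le (by positivity)).2 (hP k)
  obtain ⟨R, hR⟩ := cauchySeq_tendsto_of_complete
    (cauchySeq_of_le_geometric (1 / 2) (ε / 4) (by norm_num) hQ)
  have hR' : ∀ t, Tendsto (fun k => Q k t) atTop (𝓝 (R t)) := fun t =>
    ((continuous_eval_const t).tendsto R).comp hR
  have hd : dist (Q 0) R ≤ ε / 2 := by
    have := dist_le_of_le_geometric_of_tendsto₀ (1 / 2) (ε / 4) (by norm_num) hQ hR
    norm_num at this
    linarith
  have hδ0 : Tendsto δ atTop (𝓝 0) := by
    refine squeeze_zero (fun k => (hδ k).le) (fun k => min_le_right _ _) ?_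
    have := (tendsto_pow_atTop_nhds_zero_of_lt_one (r := (1 / 2 : ℝ)) (by norm_num)
      (by norm_num)).const_mul (ε / 8)
    simpa [e] using this
  have hrange : ∀ t, ∃ z, φ z = R t := fun t => by
    have hcl : IsClosed (Set.range φ) := (isCompact_range hφ.continuous).isClosed
    choose z hz using fun k => (P k).2.exists_dist_lt hφ t
    suffices h : Tendsto (fun k => φ (z k)) atTop (𝓝 (R t)) from
      hcl.mem_of_tendsto h (Eventually.of_forall fun k => Set.mem_range_self _)
    refine (tendsto_iff_of_dist ?_).1 (hR' t)
    exact squeeze_zero (fun _ => dist_nonneg) (fun k => (hz k).le) hδ0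
  choose r hr using hrange
  have hrc : Continuous r := by
    rw [hφ.isEmbedding.continuous_iff]
    have : φ ∘ r = R := funext hr
    rw [this]; exact R.continuous
  refine ⟨⟨⟨r, hrc⟩, ?_, ?_⟩, fun t => ?_⟩
  · apply hφ.injective
    change φ (r 0) = _
    rw [hr]
    refine tendsto_nhds_unique (hR' 0) ?_
    simp [Q]
  · apply hφ.injective
    change φ (r 1) = _
    rw [hr]
    refine tendsto_nhds_unique (hR' 1) ?_
    simp [Q]
  · change dist (r t) x ≤ ε
    rw [← hφ.dist_eq, hr]
    have h1 : Q 0 t ∈ Metric.ball (φ x) (δ 0) :=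
      Path.segment_mem_ball (Metric.mem_ball_self (dist_nonneg.trans_lt hxy))
        (by rwa [Metric.mem_ball, hφ.dist_eq, dist_comm]) t
    have h2 : dist (Q 0 t) (R t) ≤ ε / 2 := (ContinuousMap.dist_apply_le_dist t).trans hd
    have h3 : δ 0 ≤ ε / 8 := (min_le_right _ _).trans (by simp [e])
    rw [Metric.mem_ball] at h1
    linarith [dist_triangle_left (R t) (φ x) (Q 0 t)]

theorem locallyPathConnectedSpace_of_compact {X : Type*} [MetricSpace X] [CompactSpace X]
    [LocallyConnectedSpace X] : LocallyPathConnectedSpace X := by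
  refine ⟨fun x => Metric.nhds_basis_ball.to_hasBasis (fun ε hε => ?_)
    (fun s hs => Metric.nhds_basis_ball.mem_iff.1 hs.1)⟩
  obtain ⟨δ, hδ, h⟩ := exists_path_of_dist_lt (X := X) (half_pos hε)
  refine ⟨pathComponentIn (Metric.ball x ε) x, ⟨?_, isPathConnected_pathComponentIn
    (Metric.mem_ball_self hε)⟩, pathComponentIn_subset⟩
  refine mem_of_superset (Metric.ball_mem_nhds x hδ) fun y hy => ?_
  obtain ⟨p, hp⟩ := h x y (by rwa [dist_comm])
  exact ⟨p, fun t => (hp t).trans_lt (half_lt_self hε)⟩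

/-! ### Extracting an arc from a path. -/

/-- `C` is a closed set of times containing the endpoints such that `p` takes the same value at
both ends of every gap of `C`. -/
structure IsGapClosed {X : Type*} (p : unitInterval → X) (C : Set unitInterval) : Prop where
  isClosed : IsClosed C
  zero_mem : 0 ∈ C
  one_mem : 1 ∈ C
  gap : ∀ s ∈ C, ∀ t ∈ C, s < t → Set.Ioo s t ∩ C = ∅ → p s = p t

theorem IsGapClosed.univ {X : Type*} (p : unitInterval → X) : IsGapClosed p Set.univ where
  isClosed := isClosed_univ
  zero_mem := trivial
  one_mem := trivial
  gap s _ t _ hst h := by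
    obtain ⟨w, hw⟩ := exists_between hst
    exact absurd h (Set.Nonempty.ne_empty ⟨w, hw, trivial⟩)

/-- If `p` differed at the ends of a gap of the intersection, disjoint neighbourhoods of the two
values would leave a compact middle interval `[a, b]`. By compactness one member of the chain
already misses it, and the gap of that member around `[a, b]` has ends with values in the disjoint
neighbourhoods. -/
theorem IsGapClosed.sInter {X : Type*} [TopologicalSpace X] [T2Space X] {p : unitInterval → X}
    (hp : Continuous p) {c : Set (Set unitInterval)} (hne : c.Nonempty)
    (hc : ∀ C ∈ c, IsGapClosed p C) (hchain : IsChain (· ⊆ ·) c) : IsGapClosed p (⋂₀ c) where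
  isClosed := isClosed_sInter fun C hC => (hc C hC).isClosed
  zero_mem := fun C hC => (hc C hC).zero_mem
  one_mem := fun C hC => (hc C hC).one_mem
  gap s hs t ht hst hgap := by
    by_contra hne'
    obtain ⟨U, V, hU, hV, hsU, htV, hUV⟩ := t2_separation hne'
    obtain ⟨a, hsa, ha⟩ := exists_Ico_subset_of_mem_nhds
      ((hU.preimage hp).mem_nhds hsU) ⟨t, hst⟩
    obtain ⟨b, hbt, hb⟩ := exists_Ioc_subset_of_mem_nhds
      ((hV.preimage hp).mem_nhds htV) ⟨s, hst⟩
    have hab : a ≤ b := by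
      by_contra hba
      rw [not_le] at hba
      obtain ⟨w, hw1, hw2⟩ := exists_between (max_lt (lt_min hsa hst) (lt_min hba hbt))
      rw [max_lt_iff] at hw1
      rw [lt_min_iff] at hw2
      exact Set.disjoint_left.1 hUV (ha ⟨hw1.1.le, hw2.1⟩) (hb ⟨hw1.2, hw2.2.le⟩)
    have : Nonempty c := hne.to_subtype
    obtain ⟨⟨C, hC⟩, hCab⟩ := (isCompact_Icc (a := a) (b := b)).elim_directed_family_closed
      (fun C : c => (C : Set unitInterval)) (fun C => (hc C C.2).isClosed)
      (by
        rw [← Set.sInter_eq_iInter, Set.eq_empty_iff_forall_notMem] at *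
        rintro w ⟨hw, hw'⟩
        exact hgap w ⟨⟨hsa.trans_le hw.1, hw.2.trans_lt hbt⟩, hw'⟩)
      (fun A B => (hchain.total A.2 B.2).elim (fun h => ⟨A, subset_rfl, h⟩)
        (fun h => ⟨B, h, subset_rfl⟩))
    have hCc := hc C hC
    obtain ⟨s', ⟨hs'C, hs'1⟩, hs'2⟩ := ((hCc.isClosed.inter isClosed_Icc).isCompact
      (s := C ∩ Set.Icc s a)).exists_isGreatest ⟨s, hs C hC, le_rfl, hsa.le⟩
    obtain ⟨t', ⟨ht'C, ht'1⟩, ht'2⟩ := ((hCc.isClosed.inter isClosed_Icc).isCompact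
      (s := C ∩ Set.Icc b t)).exists_isLeast ⟨t, ht C hC, hbt.le, le_rfl⟩
    rw [Set.eq_empty_iff_forall_notMem] at hCab
    have hs'a : s' < a := hs'1.2.lt_of_ne fun h => hCab a ⟨⟨le_rfl, hab⟩, h ▸ hs'C⟩
    have hbt' : b < t' := ht'1.1.lt_of_ne fun h => hCab b ⟨⟨hab, le_rfl⟩, h ▸ ht'C⟩
    have heq : p s' = p t' := by
      refine hCc.gap s' hs'C t' ht'C (hs'a.trans (hab.trans_lt hbt')) ?_
      rw [Set.eq_empty_iff_forall_notMem]
      rintro w ⟨⟨hw1, hw2⟩, hwC⟩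
      rcases le_total w a with hwa | hwa
      · exact hw1.not_ge (hs'2 ⟨hwC, hs'1.1.trans hw1.le, hwa⟩)
      rcases le_total b w with hwb | hwb
      · exact hw2.not_ge (ht'2 ⟨hwC, hwb, hw2.le.trans ht'1.2⟩)
      · exact hCab w ⟨⟨hwa, hwb⟩, hwC⟩
    exact Set.disjoint_left.1 hUV (ha ⟨hs'1.1, hs'a⟩) (heq ▸ hb ⟨hbt', ht'1.2⟩)

theorem exists_minimal_isGapClosed {X : Type*} [TopologicalSpace X] [T2Space X]
    {p : unitInterval → X} (hp : Continuous p) :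
    ∃ C, IsGapClosed p C ∧ ∀ s ∈ C, ∀ t ∈ C, s < t → p s = p t → Set.Ioo s t ∩ C = ∅ := by
  obtain ⟨C, hC, hmin⟩ := zorn_superset {C | IsGapClosed p C} (fun c hc hchain => by
    rcases c.eq_empty_or_nonempty with rfl | hne
    · exact ⟨Set.univ, IsGapClosed.univ p, by simp⟩
    · exact ⟨_, IsGapClosed.sInter hp hne hc hchain, fun C hC => Set.sInter_subset_of_mem hC⟩)
  refine ⟨C, hC, fun s hs t ht hst hpst => ?_⟩
  -- Equal values at `s` and `t` allow the loop between them to be cut out, so minimality leaves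
  -- nothing of `C` there.
  have hD : IsGapClosed p (C \ Set.Ioo s t) := by
    refine ⟨hC.isClosed.sdiff isOpen_Ioo, ⟨hC.zero_mem, fun h => ?_⟩, ⟨hC.one_mem, fun h => ?_⟩,
      fun u hu v hv huv hgap => ?_⟩
    · exact h.1.not_ge unitInterval.nonneg'
    · exact h.2.not_ge unitInterval.le_one'
    · rw [Set.eq_empty_iff_forall_notMem] at hgap
      have hsD : s ∈ C \ Set.Ioo s t := ⟨hs, fun h => lt_irrefl _ h.1⟩
      have htD : t ∈ C \ Set.Ioo s t := ⟨ht, fun h => lt_irrefl _ h.2⟩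
      by_cases h : u < t ∧ s < v
      · have hus : u ≤ s := not_lt.1 fun h' => hu.2 ⟨h', h.1⟩
        have htv : t ≤ v := not_lt.1 fun h' => hv.2 ⟨h.2, h'⟩
        have h1 : u = s := hus.eq_or_lt.resolve_right fun h' => hgap s ⟨⟨h', h.2⟩, hsD⟩
        have h2 : t = v := htv.eq_or_lt.resolve_right fun h' => hgap t ⟨⟨h.1, h'⟩, htD⟩
        rw [h1, hpst, h2]
      · refine hC.gap u hu.1 v hv.1 huv (Set.eq_empty_iff_forall_notMem.2 ?_)
        rintro w ⟨hw, hwC⟩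
        refine hgap w ⟨hw, hwC, fun hw' => h ⟨?_, ?_⟩⟩
        · exact hw.1.trans hw'.2
        · exact hw'.1.trans hw.2
  have := hmin hD Set.sdiff_subset
  rw [Set.eq_empty_iff_forall_notMem]
  exact fun w hw => (this hw.2).2 hw.1

/-- Cutting out the loops of a path: there is a path with the same endpoints, with image contained
in the image of the given one, that takes each value on an order-convex set of times. -/
theorem exists_ordConnected_fibers {X : Type*} [TopologicalSpace X] [T2Space X]
    {p : unitInterval → X} (hp : Continuous p) :
    ∃ q : unitInterval → X, Continuous q ∧ q 0 = p 0 ∧ q 1 = p 1 ∧ Set.range q ⊆ Set.range p ∧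
      ∀ s t w, s ≤ w → w ≤ t → q s = q t → q w = q s := by
  obtain ⟨C, hC, hmin⟩ := exists_minimal_isGapClosed hp
  -- `σ t` and `τ t` are the nearest points of `C` below and above `t`. The map `σ` may jump, but
  -- only across gaps, where `p` takes equal values; hence `p ∘ σ` is continuous.
  choose σ hσ hσ' using fun t => ((hC.isClosed.inter isClosed_Iic).isCompact
    (s := C ∩ Set.Iic t)).exists_isGreatest ⟨0, hC.zero_mem, unitInterval.nonneg'⟩
  choose τ hτ hτ' using fun t => ((hC.isClosed.inter isClosed_Ici).isCompact
    (s := C ∩ Set.Ici t)).exists_isLeast ⟨1, hC.one_mem, unitInterval.le_one'⟩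
  have hle : ∀ t, σ t ≤ t := fun t => (hσ t).2
  have hge : ∀ t, t ≤ τ t := fun t => (hτ t).2
  have hσC : ∀ t ∈ C, σ t = t := fun t ht => le_antisymm (hσ t).2 (hσ' t ⟨ht, Set.self_mem_Iic⟩)
  have hmono : ∀ s t, s ≤ t → σ s ≤ σ t := fun s t hst =>
    hσ' t ⟨(hσ s).1, (hσ s).2.trans hst⟩
  have hστ : ∀ t, p (σ t) = p (τ t) := fun t => by
    rcases ((hle t).trans (hge t)).eq_or_lt with h | h
    · rw [h]
    · refine hC.gap _ (hσ t).1 _ (hτ t).1 h (Set.eq_empty_iff_forall_notMem.2 ?_)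
      rintro w ⟨hw, hwC⟩
      rcases le_total w t with hwt | hwt
      · exact hw.1.not_ge (hσ' t ⟨hwC, hwt⟩)
      · exact hw.2.not_ge (hτ' t ⟨hwC, hwt⟩)
  refine ⟨fun t => p (σ t), ?_, congrArg p (hσC 0 hC.zero_mem),
    congrArg p (hσC 1 hC.one_mem), ?_, ?_⟩
  · rw [continuous_iff_continuousAt]
    intro t₀
    by_cases ht₀ : t₀ ∈ C
    · intro V hV
      replace hV : V ∈ 𝓝 (p t₀) := by simpa only [hσC t₀ ht₀] using hV
      obtain ⟨ε, hε, hεV⟩ := Metric.mem_nhds_iff.1 (hp.continuousAt hV)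
      refine mem_map.2 (mem_of_superset (Metric.ball_mem_nhds t₀ hε) fun t ht => ?_)
      rw [Metric.mem_ball, Subtype.dist_eq, Real.dist_eq, abs_lt] at ht
      rcases le_total t₀ t with h | h
      · change σ t ∈ p ⁻¹' V
        refine hεV ?_
        have h1 : (t₀ : ℝ) ≤ σ t := hσ' t ⟨ht₀, h⟩
        have h2 : (σ t : ℝ) ≤ t := (hσ t).2
        rw [Metric.mem_ball, Subtype.dist_eq, Real.dist_eq, abs_lt]
        constructor <;> linarith
      -- To the left of `t₀`, `σ t` may be far from `t₀`, whereas `τ t` lies between `t` and `t₀`.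
      · change p (σ t) ∈ V
        rw [hστ]
        change τ t ∈ p ⁻¹' V
        refine hεV ?_
        have h1 : (τ t : ℝ) ≤ t₀ := hτ' t ⟨ht₀, h⟩
        have h2 : (t : ℝ) ≤ τ t := (hτ t).2
        rw [Metric.mem_ball, Subtype.dist_eq, Real.dist_eq, abs_lt]
        constructor <;> linarith
    · have h1 : σ t₀ < t₀ := (hσ t₀).2.lt_of_ne fun h => ht₀ (h ▸ (hσ t₀).1)
      have h2 : t₀ < τ t₀ := lt_of_le_of_ne (hτ t₀).2 fun h => ht₀ (h ▸ (hτ t₀).1)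
      have : ∀ᶠ t in 𝓝 t₀, p (σ t₀) = p (σ t) := by
        filter_upwards [Ioo_mem_nhds h1 h2] with t ht
        congr 1
        have h3 : σ t ≤ t₀ := not_lt.1 fun h =>
          ((hle t).trans_lt ht.2).not_ge (hτ' t₀ ⟨(hσ t).1, h.le⟩)
        exact le_antisymm (hσ' t ⟨(hσ t₀).1, ht.1.le⟩) (hσ' t₀ ⟨(hσ t).1, h3⟩)
      exact continuousAt_const.congr this
  · rintro _ ⟨t, rfl⟩
    exact Set.mem_range_self _
  · intro s t w hsw hwt hst
    dsimp only at hst ⊢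
    rcases (hmono s w hsw).eq_or_lt with h1 | h1
    · rw [h1]
    rcases (hmono w t hwt).eq_or_lt with h2 | h2
    · rw [h2, hst]
    have := hmin _ (hσ s).1 _ (hσ t).1 (h1.trans h2) hst
    exact absurd this (Set.Nonempty.ne_empty ⟨σ w, ⟨h1, h2⟩, (hσ w).1⟩)

/-- The running maximum of a continuous function on `[0, 1]`. -/
noncomputable def runningMax (φ : unitInterval → ℝ) (t : unitInterval) : ℝ :=
  sSup ((fun s => φ (min s t)) '' Set.univ)

section RunningMax

variable {φ : unitInterval → ℝ}

/-- Writing `min s t` makes the supremum range over a fixed compact set. -/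
theorem continuous_runningMax (hφ : Continuous φ) : Continuous (runningMax φ) :=
  isCompact_univ.continuous_sSup (f := fun t s => φ (min s t))
    (hφ.comp (continuous_snd.min continuous_fst))

theorem le_runningMax (hφ : Continuous φ) {s t : unitInterval} (hst : s ≤ t) :
    φ s ≤ runningMax φ t := by
  refine le_csSup (isCompact_univ.image (by fun_prop)).bddAbove ⟨s, trivial, ?_⟩
  simp [hst]

theorem runningMax_le {t : unitInterval} {a : ℝ} (h : ∀ s ≤ t, φ s ≤ a) :
    runningMax φ t ≤ a := by
  refine csSup_le (Set.univ_nonempty.image _) ?_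
  rintro _ ⟨s, -, rfl⟩
  exact h _ (min_le_right _ _)

theorem monotone_runningMax (hφ : Continuous φ) : Monotone (runningMax φ) := fun _ _ h =>
  runningMax_le fun _ hr => le_runningMax hφ (hr.trans h)

theorem runningMax_eq {s t : unitInterval} (hφ : Continuous φ) (hst : s ≤ t)
    (h : ∀ w, s ≤ w → w ≤ t → φ w = φ s) : runningMax φ s = runningMax φ t := by
  refine le_antisymm (monotone_runningMax hφ hst) (runningMax_le fun w hw => ?_)
  rcases le_total w s with hws | hws
  · exact le_runningMax hφ hws
  · rw [h w hws hw]
    exact le_runningMax hφ le_rfl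

end RunningMax

/-- A path with order-convex fibers factors through a monotone function with the same fibers. -/
theorem exists_monotone_collapse {X : Type*} [MetricSpace X] {q : unitInterval → X}
    (hq : Continuous q) (hfib : ∀ s t w, s ≤ w → w ≤ t → q s = q t → q w = q s) :
    ∃ G : unitInterval → ℝ, Continuous G ∧ ∀ s t, s ≤ t → G s ≤ G t ∧ (G s = G t ↔ q s = q t) := by
  let r : ℕ → unitInterval := TopologicalSpace.denseSeq unitInterval
  -- `φ n` vanishes up to `r n`. If `q s ≠ q t`, some `r n` between `s` and `t` has `q (r n) ≠ q t`;
  -- convexity of fibers keeps `q t` out of `q '' Set.Iic (r n)`, so the `n`-th running maximum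
  -- grows from `s` to `t`. The cap `1` makes the weighted sum converge.
  let φ : ℕ → unitInterval → ℝ := fun n t => min 1 (Metric.infDist (q t) (q '' Set.Iic (r n)))
  have hφ : ∀ n, Continuous (φ n) := fun n =>
    continuous_const.min ((Metric.continuous_infDist_pt _).comp hq)
  have hφ0 : ∀ n t, 0 ≤ φ n t := fun n t => le_min zero_le_one Metric.infDist_nonneg
  have hM0 : ∀ n t, 0 ≤ runningMax (φ n) t := fun n t =>
    (hφ0 n t).trans (le_runningMax (hφ n) le_rfl)
  have hM1 : ∀ n t, runningMax (φ n) t ≤ 1 := fun n t =>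
    runningMax_le fun s _ => min_le_left _ _
  let g : ℕ → unitInterval → ℝ := fun n t => (1 / 2) ^ n * runningMax (φ n) t
  have hbound : ∀ n t, ‖g n t‖ ≤ (1 / 2 : ℝ) ^ n := fun n t => by
    have h2 : (0 : ℝ) ≤ (1 / 2) ^ n := by positivity
    rw [Real.norm_of_nonneg (mul_nonneg h2 (hM0 n t))]
    exact mul_le_of_le_one_right h2 (hM1 n t)
  have hsum : ∀ t, Summable fun n => g n t := fun t =>
    Summable.of_norm_bounded summable_geometric_two (fun n => hbound n t)
  have hmono : ∀ n, Monotone (g n) := fun n s t hst =>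
    mul_le_mul_of_nonneg_left (monotone_runningMax (hφ n) hst) (by positivity)
  refine ⟨fun t => ∑' n, g n t, continuous_tsum (fun n =>
    continuous_const.mul (continuous_runningMax (hφ n))) summable_geometric_two hbound,
    fun s t hst => ⟨(hsum s).tsum_le_tsum (fun n => hmono n hst) (hsum t), fun h => ?_,
      fun h => ?_⟩⟩
  · by_contra hne
    have hV : IsOpen {w | q w ≠ q t} := isOpen_ne_fun hq continuous_const
    have hst' : s < t := hst.lt_of_ne fun h => hne (h ▸ rfl)
    obtain ⟨a, hsa, ha⟩ := exists_Ico_subset_of_mem_nhds (hV.mem_nhds hne) ⟨t, hst'⟩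
    obtain ⟨n, hn⟩ := (TopologicalSpace.denseRange_denseSeq unitInterval).exists_mem_open
      isOpen_Ioo (Set.nonempty_Ioo.2 (lt_min hsa hst'))
    have hrs : s < r n := hn.1
    have hrt : r n < t := hn.2.trans_le (min_le_right _ _)
    have hrne : q (r n) ≠ q t := ha ⟨hrs.le, hn.2.trans_le (min_le_left _ _)⟩
    have h0 : runningMax (φ n) s = 0 := le_antisymm (runningMax_le fun w hw => by
      have : Metric.infDist (q w) (q '' Set.Iic (r n)) = 0 :=
        Metric.infDist_zero_of_mem ⟨w, hw.trans hrs.le, rfl⟩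
      simp [φ, this]) (hM0 n s)
    have h1 : 0 < runningMax (φ n) t := by
      refine lt_of_lt_of_le (lt_min one_pos ?_) (le_runningMax (hφ n) le_rfl)
      refine (IsClosed.notMem_iff_infDist_pos ?_ (Set.nonempty_Iic.image q)).1 ?_
      · exact (isClosed_Iic.isCompact.image hq).isClosed
      · rintro ⟨w, hw, hwt⟩
        exact hrne ((hfib w t (r n) hw hrt.le hwt).trans hwt)
    have hlt : g n s < g n t := by
      simp only [g, h0]
      exact mul_lt_mul_of_pos_left h1 (by positivity)
    exact ((hsum s).tsum_lt_tsum (fun n => hmono n hst) hlt (hsum t)).ne h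
  · refine tsum_congr fun n => ?_
    simp only [g]
    rw [runningMax_eq (hφ n) hst fun w hsw hwt => ?_]
    simp only [φ]
    rw [hfib s t w hsw hwt h]

/-- The collapsing function, rescaled to a surjection `H` of `[0, 1]`, is a quotient map with the
same fibers as `q`, so `q` descends along it to an injective path. -/
theorem exists_injective_of_ordConnected_fibers {X : Type*} [MetricSpace X]
    {q : unitInterval → X} (hq : Continuous q)
    (hfib : ∀ s t w, s ≤ w → w ≤ t → q s = q t → q w = q s) (hne : q 0 ≠ q 1) :
    ∃ γ : unitInterval → X, IsArcParam γ (q 0) (q 1) ∧ Set.range γ ⊆ Set.range q := by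
  obtain ⟨G, hG, hGq⟩ := exists_monotone_collapse hq hfib
  have hmono : ∀ s t, s ≤ t → G s ≤ G t := fun s t h => (hGq s t h).1
  have hiff : ∀ s t, G s = G t ↔ q s = q t := fun s t => by
    rcases le_total s t with h | h
    · exact (hGq s t h).2
    · rw [eq_comm, (hGq t s h).2, eq_comm]
  have hlt : G 0 < G 1 := (hmono 0 1 zero_le_one).lt_of_ne fun h => hne ((hiff 0 1).1 h)
  have hpos : 0 < G 1 - G 0 := sub_pos.2 hlt
  let H : unitInterval → unitInterval := fun t => ⟨(G t - G 0) / (G 1 - G 0),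
    div_nonneg (sub_nonneg.2 (hmono 0 t unitInterval.nonneg')) hpos.le,
    (div_le_one hpos).2 (sub_le_sub_right (hmono t 1 unitInterval.le_one') _)⟩
  have hH : Continuous H := by
    refine Continuous.subtype_mk ?_ _
    exact (hG.sub continuous_const).div_const _
  have hHG : ∀ s t, H s = H t ↔ q s = q t := fun s t => by
    rw [← hiff, Subtype.ext_iff]
    change (G s - G 0) / (G 1 - G 0) = (G t - G 0) / (G 1 - G 0) ↔ _
    rw [div_left_inj' hpos.ne', sub_left_inj]
  have hH0 : H 0 = 0 := by simp [H]
  have hH1 : H 1 = 1 := Subtype.ext (div_self hpos.ne')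
  have hsurj : Function.Surjective H := fun y => by
    have := intermediate_value_univ 0 1 hH
    rw [hH0, hH1] at this
    exact this ⟨unitInterval.nonneg', unitInterval.le_one'⟩
  let γ : unitInterval → X := fun y => q (Function.surjInv hsurj y)
  have hγH : ∀ t, γ (H t) = q t := fun t => (hHG _ _).1 (Function.surjInv_eq hsurj (H t))
  have hγ : Continuous γ := by
    rw [(hH.isClosedMap.isQuotientMap hH hsurj).continuous_iff]
    have : γ ∘ H = q := funext hγH
    rwa [this]
  have hinj : Function.Injective γ := fun x y hxy => by
    obtain ⟨s, rfl⟩ := hsurj x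
    obtain ⟨t, rfl⟩ := hsurj y
    rw [hγH, hγH] at hxy
    exact (hHG s t).2 hxy
  refine ⟨γ, ⟨(hγ.isClosedEmbedding hinj).isEmbedding, ?_, ?_⟩, ?_⟩
  · rw [← hH0, hγH, hH0]
  · rw [← hH1, hγH, hH1]
  · rintro _ ⟨y, rfl⟩
    exact Set.mem_range_self _

/-- Every path between distinct points contains an arc between them. -/
theorem Path.exists_isArcParam {X : Type*} [MetricSpace X] {x y : X} (p : Path x y)
    (hxy : x ≠ y) : ∃ γ : unitInterval → X, IsArcParam γ x y ∧ Set.range γ ⊆ Set.range p := by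
  obtain ⟨q, hq, h0, h1, hr, hfib⟩ := exists_ordConnected_fibers p.continuous
  rw [p.source] at h0
  rw [p.target] at h1
  obtain ⟨γ, hγ, hγr⟩ := exists_injective_of_ordConnected_fibers hq hfib (by rwa [h0, h1])
  rw [h0, h1] at hγ
  exact ⟨γ, hγ, hγr.trans hr⟩

/-! ### Jordan curves and uniqueness of arcs. -/

/-- The affine map of `[0, 1]` into itself taking `0` to `s` and `1` to `t`. -/
def unitInterval.affine (s t l : unitInterval) : unitInterval :=
  ⟨(1 - l) * s + l * t, (convex_Icc (0 : ℝ) 1) s.2 t.2 (sub_nonneg.2 l.2.2) l.2.1 (by ring)⟩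

namespace unitInterval

theorem coe_affine (s t l : unitInterval) : (affine s t l : ℝ) = (1 - l) * s + l * t := rfl

theorem continuous_affine (s t : unitInterval) : Continuous (affine s t) := by
  refine Continuous.subtype_mk ?_ _
  fun_prop

@[simp] theorem affine_zero (s t : unitInterval) : affine s t 0 = s :=
  Subtype.ext (by simp [coe_affine])

@[simp] theorem affine_one (s t : unitInterval) : affine s t 1 = t :=
  Subtype.ext (by simp [coe_affine])

theorem affine_injective {s t : unitInterval} (h : s ≠ t) : Function.Injective (affine s t) := by
  intro l m hlm
  have h1 : (t : ℝ) - s ≠ 0 := sub_ne_zero.2 fun h' => h (Subtype.ext h'.symm)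
  have h2 := congrArg (Subtype.val) hlm
  rw [coe_affine, coe_affine] at h2
  refine Subtype.ext (mul_right_cancel₀ h1 ?_)
  linarith

theorem affine_mem_Icc {s t : unitInterval} (h : s ≤ t) (l : unitInterval) :
    affine s t l ∈ Set.Icc s t := by
  have h' : (s : ℝ) ≤ t := h
  refine ⟨?_, ?_⟩
  · change (s : ℝ) ≤ _
    rw [coe_affine]
    nlinarith [mul_le_mul_of_nonneg_left h' l.2.1]
  · change _ ≤ (t : ℝ)
    rw [coe_affine]
    nlinarith [mul_le_mul_of_nonneg_left h' (sub_nonneg.2 l.2.2)]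

end unitInterval

open unitInterval in
theorem IsArcParam.comp_affine {X : Type*} [TopologicalSpace X] [T2Space X] {γ : unitInterval → X}
    {a b : X} (hγ : IsArcParam γ a b) {s t : unitInterval} (h : s ≠ t) :
    IsArcParam (γ ∘ affine s t) (γ s) (γ t) where
  embedding := hγ.embedding.comp
    ((continuous_affine s t).isClosedEmbedding (affine_injective h)).isEmbedding
  left := by simp
  right := by simp

/-- Two arcs that meet in their endpoints only form a Jordan curve. -/
theorem exists_circle_isEmbedding {X : Type*} [TopologicalSpace X] [T2Space X]
    {γ₁ γ₂ : unitInterval → X} {x y : X} (h₁ : IsArcParam γ₁ x y) (h₂ : IsArcParam γ₂ x y)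
    (h : ∀ s t, γ₁ s = γ₂ t → s = 0 ∨ s = 1) : ∃ g : Circle → X, IsEmbedding g := by
  have hsq : ∀ z : Circle, (z : ℂ).re * (z : ℂ).re + (z : ℂ).im * (z : ℂ).im = 1 := fun z => by
    rw [← Complex.normSq_apply]; exact Circle.normSq_coe z
  -- Projection to the real axis, rescaled so that `1` goes to `0` and `-1` to `1`; the closed upper
  -- half of the circle follows `γ₁`, the lower half `γ₂`.
  let l : Circle → unitInterval := fun z => ⟨(1 - (z : ℂ).re) / 2, by
    constructor <;> nlinarith [hsq z, mul_self_nonneg (z : ℂ).im]⟩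
  have hl : Continuous l := by
    refine Continuous.subtype_mk ?_ _
    exact (continuous_const.sub (Complex.continuous_re.comp continuous_induced_dom)).div_const _
  have hlv : ∀ z, (l z : ℝ) = (1 - (z : ℂ).re) / 2 := fun z => rfl
  have him : ∀ z : Circle, l z = 0 ∨ l z = 1 ↔ (z : ℂ).im = 0 := fun z => by
    rw [Subtype.ext_iff, Subtype.ext_iff, hlv]
    constructor
    · rintro (h | h)
      · have h' : (z : ℂ).re = 1 := by
          have : (1 - (z : ℂ).re) / 2 = 0 := h
          linarith
        have := hsq z
        rw [h'] at this
        exact mul_self_eq_zero.1 (by linarith)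
      · have h' : (z : ℂ).re = -1 := by
          have : (1 - (z : ℂ).re) / 2 = 1 := h
          linarith
        have := hsq z
        rw [h'] at this
        exact mul_self_eq_zero.1 (by linarith)
    · intro h
      have h1 := hsq z
      rw [h] at h1
      rcases mul_self_eq_one_iff.1 (by linarith : (z : ℂ).re * (z : ℂ).re = 1) with h2 | h2
      · left; rw [h2]; simp
      · right; rw [h2]; norm_num
  have hext : ∀ z w : Circle, l z = l w → ((0 ≤ (z : ℂ).im ∧ 0 ≤ (w : ℂ).im) ∨
      ((z : ℂ).im < 0 ∧ (w : ℂ).im < 0)) → z = w := fun z w hzw hs => by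
    have h1 : (z : ℂ).re = (w : ℂ).re := by
      have := congrArg Subtype.val hzw
      rw [hlv, hlv] at this
      linarith
    have h2 : (z : ℂ).im * (z : ℂ).im = (w : ℂ).im * (w : ℂ).im := by
      have h3 := hsq z
      have h4 := hsq w
      rw [h1] at h3
      linarith
    refine Circle.ext (Complex.ext h1 ?_)
    rcases mul_self_eq_mul_self_iff.1 h2 with h3 | h3
    · exact h3
    · rcases hs with hs | hs <;> linarith [hs.1, hs.2]
  have hcross : ∀ z w : Circle, (w : ℂ).im < 0 → γ₁ (l z) ≠ γ₂ (l w) := fun z w hw hzw => by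
    refine hw.ne ((him w).1 ?_)
    rcases h _ _ hzw with h0 | h0
    · rw [h0, h₁.left, ← h₂.left] at hzw
      exact Or.inl (h₂.embedding.injective hzw).symm
    · rw [h0, h₁.right, ← h₂.right] at hzw
      exact Or.inr (h₂.embedding.injective hzw).symm
  let g : Circle → X := fun z => if 0 ≤ (z : ℂ).im then γ₁ (l z) else γ₂ (l z)
  have hg : Continuous g := by
    refine Continuous.if_le (h₁.embedding.continuous.comp hl) (h₂.embedding.continuous.comp hl)
      continuous_const (Complex.continuous_im.comp continuous_induced_dom) fun z hz => ?_
    rcases (him z).2 hz.symm with h0 | h0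
    · simp only [h0, h₁.left, h₂.left]
    · simp only [h0, h₁.right, h₂.right]
  refine ⟨g, (hg.isClosedEmbedding fun z w hzw => ?_).isEmbedding⟩
  simp only [g] at hzw
  split_ifs at hzw with hz hw hw
  · exact hext z w (h₁.embedding.injective hzw) (Or.inl ⟨hz, hw⟩)
  · exact absurd hzw (hcross z w (not_le.1 hw))
  · exact absurd hzw.symm (hcross w z (not_le.1 hz))
  · exact hext z w (h₂.embedding.injective hzw) (Or.inr ⟨not_le.1 hz, not_le.1 hw⟩)

/-- In a space without Jordan curves, an arc is contained in any other arc with the same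
endpoints. -/
theorem IsArcParam.range_subset {X : Type*} [TopologicalSpace X] [T2Space X]
    (hJ : ¬ ∃ g : Circle → X, IsEmbedding g) {γ γ' : unitInterval → X} {x y : X}
    (hγ : IsArcParam γ x y) (hγ' : IsArcParam γ' x y) : Set.range γ ⊆ Set.range γ' := by
  rintro _ ⟨m, rfl⟩
  by_contra hm
  have hA : IsClosed (γ ⁻¹' Set.range γ') :=
    (isCompact_range hγ'.embedding.continuous).isClosed.preimage hγ.embedding.continuous
  -- Around `m`, the interval `(s, t)` is the maximal stretch of `γ` off `γ'`; with the part of `γ'`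
  -- joining its ends it closes up to a Jordan curve.
  obtain ⟨s, ⟨⟨s', hs'⟩, hsm⟩, hs⟩ := ((hA.inter isClosed_Iic).isCompact
    (s := γ ⁻¹' Set.range γ' ∩ Set.Iic m)).exists_isGreatest
    ⟨0, ⟨0, by rw [hγ.left, hγ'.left]⟩, unitInterval.nonneg'⟩
  obtain ⟨t, ⟨⟨t', ht'⟩, hmt⟩, ht⟩ := ((hA.inter isClosed_Ici).isCompact
    (s := γ ⁻¹' Set.range γ' ∩ Set.Ici m)).exists_isLeast
    ⟨1, ⟨1, by rw [hγ.right, hγ'.right]⟩, unitInterval.le_one'⟩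
  have hsm' : s < m := lt_of_le_of_ne hsm fun h => hm ⟨s', h ▸ hs'⟩
  have hmt' : m < t := lt_of_le_of_ne hmt fun h => hm ⟨t', by rw [ht', ← h]⟩
  have hst := hsm'.trans hmt'
  have hst' : s' ≠ t' := fun h => hst.ne (hγ.embedding.injective (by rw [← hs', ← ht', h]))
  have h1 := hγ.comp_affine hst.ne
  have h2 := hγ'.comp_affine hst'
  rw [hs', ht'] at h2
  refine hJ (exists_circle_isEmbedding h1 h2 fun k k' hk => ?_)
  have hmem := unitInterval.affine_mem_Icc hst.le k
  have hmemA : unitInterval.affine s t k ∈ γ ⁻¹' Set.range γ' := ⟨_, hk.symm⟩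
  rcases le_total (unitInterval.affine s t k) m with hkm | hkm
  · left
    refine unitInterval.affine_injective hst.ne ?_
    rw [unitInterval.affine_zero]
    exact le_antisymm (hs ⟨hmemA, hkm⟩) hmem.1
  · right
    refine unitInterval.affine_injective hst.ne ?_
    rw [unitInterval.affine_one]
    exact le_antisymm hmem.2 (ht ⟨hmemA, hkm⟩)

theorem IsArcParam.range_subset_path {X : Type*} [MetricSpace X]
    (hJ : ¬ ∃ g : Circle → X, IsEmbedding g) {γ : unitInterval → X} {x y : X}
    (hγ : IsArcParam γ x y) (p : Path x y) : Set.range γ ⊆ Set.range p := by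
  have hxy : x ≠ y := fun h =>
    zero_ne_one (hγ.embedding.injective ((hγ.left.trans h).trans hγ.right.symm))
  obtain ⟨γ', hγ', h⟩ := p.exists_isArcParam hxy
  exact (hγ.range_subset hJ hγ').trans h

/-! ### Sides of a point and the separation order. -/

/-- The connected component of `x` in the complement of the point `m`. -/
def side {X : Type*} [TopologicalSpace X] (m x : X) : Set X := connectedComponentIn {m}ᶜ x

section Side

variable {X : Type*} [TopologicalSpace X] {m x y : X}

theorem mem_side_self (h : x ≠ m) : x ∈ side m x := mem_connectedComponentIn h

theorem notMem_side : m ∉ side m x := fun h => connectedComponentIn_subset _ _ h rfl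

theorem isPreconnected_side : IsPreconnected (side m x) := isPreconnected_connectedComponentIn

theorem mem_side_of_isPreconnected {s : Set X} (hs : IsPreconnected s) (hm : m ∉ s) (hx : x ∈ s)
    (hy : y ∈ s) : y ∈ side m x :=
  hs.subset_connectedComponentIn hx (fun z hz (h : z = m) => hm (h ▸ hz)) hy

theorem side_eq (h : y ∈ side m x) : side m x = side m y := connectedComponentIn_eq h

/-- The set `side m m` is empty. Thus `u ∉ side x (f x)` holds also when `f x = x`, as well as when
`x = u`. -/
theorem ne_of_mem_side (h : y ∈ side m x) : x ≠ m ∧ y ≠ m := by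
  refine ⟨fun h' => ?_, fun h' => notMem_side (h' ▸ h)⟩
  rw [side, connectedComponentIn_eq_empty (by simp [h'])] at h
  exact h

theorem mem_side_symm (h : y ∈ side m x) : x ∈ side m y := by
  rw [← side_eq h]; exact mem_side_self (ne_of_mem_side h).1

theorem isOpen_side [T1Space X] [LocallyConnectedSpace X] : IsOpen (side m x) :=
  isOpen_compl_singleton.connectedComponentIn

theorem isClosed_insert_side [T1Space X] [LocallyConnectedSpace X] :
    IsClosed (insert m (side m x)) := by
  rw [← isOpen_compl_iff, isOpen_iff_mem_nhds]
  intro y hy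
  rw [Set.mem_compl_iff, Set.mem_insert_iff, not_or] at hy
  refine mem_of_superset (isOpen_side.mem_nhds (mem_side_self hy.1)) fun z hz hz' => ?_
  rcases hz' with rfl | hz'
  · exact notMem_side hz
  · rw [side_eq hz', ← side_eq hz] at hy
    exact hy.2 (mem_side_self hy.1)

/-- `x` separates `u` from `z`, is `u`, or is `z`; this is transitive in `x` and `z`. -/
theorem notMem_side_trans {u x y z : X} (h₁ : u ∉ side x y) (h₂ : u ∉ side y z) :
    u ∉ side x z := fun h => by
  by_cases hy : y ∈ side x z
  · exact h₁ (by rwa [← side_eq hy])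
  · exact h₂ (mem_side_of_isPreconnected isPreconnected_side hy
      (mem_side_self (ne_of_mem_side h).1) h)

theorem exists_path_of_mem_side [T1Space X] [LocallyPathConnectedSpace X] (h : y ∈ side m x) :
    ∃ p : Path x y, ∀ t, p t ≠ m := by
  have hc : IsConnected (side m x) := ⟨⟨y, h⟩, isPreconnected_side⟩
  have hp := isOpen_side.isConnected_iff_isPathConnected.1 hc
  obtain ⟨p, hp⟩ := hp.joinedIn x (mem_side_self (ne_of_mem_side h).1) y h
  exact ⟨p, fun t ht => notMem_side (ht ▸ hp t)⟩

/-- A path from `w` to `a` off `x` still works after a perturbation: `x` stays off its compact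
range, and `w` moves in a small connected set away from `x`. -/
theorem eventually_mem_side [T2Space X] [LocallyPathConnectedSpace X] {a x w : X}
    (h : a ∈ side x w) : ∀ᶠ z : X × X in 𝓝 (x, w), a ∈ side z.1 z.2 := by
  obtain ⟨p, hp⟩ := exists_path_of_mem_side h
  obtain ⟨W, V, hW, hV, hxW, hwV, hWV⟩ := t2_separation (ne_of_mem_side h).1.symm
  have hR : IsClosed (Set.range p) := (isCompact_range p.continuous).isClosed
  have hxR : x ∈ (Set.range p)ᶜ := by rintro ⟨t, ht⟩; exact hp t ht
  have hV' : IsOpen (connectedComponentIn V w) := hV.connectedComponentIn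
  filter_upwards [prod_mem_nhds ((hW.inter hR.isOpen_compl).mem_nhds ⟨hxW, hxR⟩)
    (hV'.mem_nhds (mem_connectedComponentIn hwV))] with z hz
  refine mem_side_of_isPreconnected (s := connectedComponentIn V w ∪ Set.range p)
    (isPreconnected_connectedComponentIn.union w (mem_connectedComponentIn hwV)
      ⟨0, p.source⟩ (isPreconnected_range p.continuous)) ?_ (Or.inl hz.2) (Or.inr ⟨1, p.target⟩)
  rintro (h | h)
  · exact Set.disjoint_left.1 hWV hz.1.1 (connectedComponentIn_subset _ _ h)
  · exact hz.1.2 h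

theorem isOpen_setOf_mem_side [T2Space X] [LocallyPathConnectedSpace X] (u : X) {f g : X → X}
    (hf : Continuous f) (hg : Continuous g) : IsOpen {x | u ∈ side (f x) (g x)} :=
  isOpen_iff_mem_nhds.2 fun _ hx =>
    ((hf.prodMk hg).tendsto _).eventually (eventually_mem_side hx)

theorem IsArcParam.mem_side {γ : unitInterval → X} {a b : X} (hγ : IsArcParam γ a b)
    {m s t : unitInterval} (h : m ∉ Set.uIcc s t) : γ t ∈ side (γ m) (γ s) := by
  refine mem_side_of_isPreconnected
    (Set.ordConnected_uIcc.isPreconnected.image γ hγ.embedding.continuous.continuousOn) ?_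
    (Set.mem_image_of_mem γ Set.left_mem_uIcc) (Set.mem_image_of_mem γ Set.right_mem_uIcc)
  rintro ⟨w, hw, hwm⟩
  exact h (hγ.embedding.injective hwm ▸ hw)

end Side

theorem exists_isArcParam {X : Type*} [MetricSpace X] [PathConnectedSpace X] {x y : X}
    (h : x ≠ y) : ∃ γ : unitInterval → X, IsArcParam γ x y := by
  obtain ⟨p⟩ := PathConnectedSpace.joined x y
  obtain ⟨γ, hγ, -⟩ := p.exists_isArcParam h
  exact ⟨γ, hγ⟩

theorem mem_periodicPts_of_iterate {X : Type*} {f : X → X} {k : ℕ} (hk : 0 < k) {z : X}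
    (hz : z ∈ Function.periodicPts f^[k]) : z ∈ Function.periodicPts f := by
  obtain ⟨n, hn, h⟩ := hz
  refine ⟨k * n, Nat.mul_pos hk hn, ?_⟩
  rw [Function.IsPeriodicPt, Function.iterate_mul]
  exact h

/-- Antisymmetry of the relation `u ∉ side x y`: an arc from `u` to `x` either avoids `y` or reaches
`y` before `x`. -/
theorem eq_of_notMem_side {X : Type*} [MetricSpace X] [PathConnectedSpace X] {u x y : X}
    (h₁ : u ∉ side x y) (h₂ : u ∉ side y x) : x = y := by
  by_contra hxy
  have hux : u ≠ x := fun h => h₂ (by rw [h]; exact mem_side_self hxy)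
  obtain ⟨γ, hγ⟩ := exists_isArcParam hux
  by_cases hy : y ∈ Set.range γ
  · obtain ⟨t, rfl⟩ := hy
    refine h₁ ?_
    rw [← hγ.left, ← hγ.right]
    refine hγ.mem_side fun h => ?_
    rw [Set.uIcc_of_ge unitInterval.nonneg'] at h
    have : t = 1 := le_antisymm unitInterval.le_one' h.2
    exact hxy (by rw [this, hγ.right])
  · exact h₂ (mem_side_of_isPreconnected (isPreconnected_range hγ.embedding.continuous) hy
      ⟨1, hγ.right⟩ ⟨0, hγ.left⟩)

/-! ### Separation by points of an arc. -/

section Dendrite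

variable {X : Type*} [MetricSpace X] [LocallyPathConnectedSpace X]

/-- A point of an arc separates the points before it from the points after it. -/
theorem IsArcParam.notMem_side (hJ : ¬ ∃ g : Circle → X, IsEmbedding g) {γ : unitInterval → X}
    {a b : X} (hγ : IsArcParam γ a b) {s m t : unitInterval} (hsm : s < m) (hmt : m < t) :
    γ t ∉ side (γ m) (γ s) := by
  intro h
  have h0 : γ 0 ∈ side (γ m) (γ s) := hγ.mem_side fun hm => by
    rw [Set.uIcc_of_ge unitInterval.nonneg'] at hm
    exact hsm.not_ge hm.2
  have h1 : γ 1 ∈ side (γ m) (γ t) := hγ.mem_side fun hm => by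
    rw [Set.uIcc_of_le unitInterval.le_one'] at hm
    exact hmt.not_ge hm.1
  rw [← side_eq h, side_eq h0, hγ.left, hγ.right] at h1
  obtain ⟨p, hp⟩ := exists_path_of_mem_side h1
  obtain ⟨w, hw⟩ := hγ.range_subset_path hJ p (Set.mem_range_self m)
  exact hp w hw

/-- The part of a dendrite between the end `b` of an arc and a point of the arc shrinks to `b` as
the point tends to `b`. -/
theorem IsArcParam.eventually_between_subset [CompactSpace X]
    (hJ : ¬ ∃ g : Circle → X, IsEmbedding g) {γ : unitInterval → X} {a b : X}
    (hγ : IsArcParam γ a b) {N : Set X} (hN : IsOpen N) (hb : b ∈ N) :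
    ∀ᶠ y in 𝓝 b, y ∈ openArc γ → side y b ∩ side b y ⊆ N := by
  have key : ∀ᶠ y in 𝓝 b, ∀ z ∈ Nᶜ, y ∈ openArc γ → ¬ (z ∈ side y b ∧ z ∈ side b y) := by
    refine hN.isClosed_compl.isCompact.eventually_forall_of_forall_eventually fun z hz => ?_
    have hzb : z ≠ b := fun h => hz (h ▸ hb)
    -- If `z` is on the side of `a`, a path from `z` to `a` misses `b`, hence misses every `y` near
    -- `b`, while `y` separates `a` from `b`. Otherwise `z` and `y` are on different sides of `b`.
    by_cases hza : z ∈ side b a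
    · filter_upwards [eventually_mem_side (mem_side_symm hza)]
      rintro ⟨y, w⟩ haw ⟨s, hs, rfl⟩ ⟨hw, -⟩
      rw [← side_eq hw] at haw
      have := hγ.notMem_side hJ hs.1 hs.2
      rw [hγ.left, hγ.right] at this
      exact this (mem_side_symm haw)
    · filter_upwards [prod_mem_nhds univ_mem (isOpen_side.mem_nhds (mem_side_self hzb))]
      rintro ⟨y, w⟩ ⟨-, hw⟩ ⟨s, hs, rfl⟩ ⟨-, hw'⟩
      have h1 := hγ.mem_side (m := 1) (s := 0) (t := s) fun h => by
        rw [Set.uIcc_of_le unitInterval.nonneg'] at h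
        exact hs.2.not_ge h.2
      rw [hγ.left, hγ.right] at h1
      rw [← side_eq h1] at hw'
      refine hza ?_
      rw [side_eq hw', ← side_eq hw]
      exact mem_side_self hzb
  filter_upwards [key] with y hy hyγ z hz
  by_contra hzN
  exact hy z hzN hyγ hz

/-! ### Fixed and periodic points between two points. -/

variable [PathConnectedSpace X]

/-- Following the arrow: if `f` moves `x` away from `u`, then so it does for some points slightly
further from `u` in the direction of `f x`. -/
theorem exists_further_point (hJ : ¬ ∃ g : Circle → X, IsEmbedding g) {f : X → X}
    (hf : Continuous f) {u x : X} (hu : u ∉ side x (f x)) (hx : x ≠ f x) {N : Set X}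
    (hN : N ∈ 𝓝 x) : ∃ y ∈ N, y ∈ side x (f x) ∧ u ∉ side y (f y) := by
  obtain ⟨γ, hγ⟩ := exists_isArcParam hx
  let m : unitInterval := ⟨1 / 2, by norm_num, by norm_num⟩
  have hm0 : 0 < m := by
    change (0 : ℝ) < 1 / 2
    norm_num
  have hm1 : m < 1 := by
    change (1 / 2 : ℝ) < 1
    norm_num
  have hγc := hγ.embedding.continuous
  have hfx : f x ∈ side (γ m) (f x) := by
    refine mem_side_self fun h => hm1.ne' (hγ.embedding.injective ?_)
    rw [hγ.right, h]
  have hxm : x ∉ side (γ m) (f x) := fun h => by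
    have := hγ.notMem_side hJ hm0 hm1
    rw [hγ.left, hγ.right] at this
    exact this (mem_side_symm h)
  have h1 : ∀ᶠ t in 𝓝 (0 : unitInterval), γ t ∈ N ∧ f (γ t) ∈ side (γ m) (f x) ∧ t < m := by
    refine (hγc.continuousAt.eventually_mem (by rwa [hγ.left])).and
      (((hf.comp hγc).continuousAt.eventually_mem (isOpen_side.mem_nhds ?_)).and
        (Iio_mem_nhds hm0))
    simpa [hγ.left] using hfx
  obtain ⟨c, hc, hc'⟩ := exists_Ico_subset_of_mem_nhds h1 ⟨1, zero_lt_one⟩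
  obtain ⟨t, ht0, htc⟩ := exists_between hc
  obtain ⟨htN, htf, htm⟩ := hc' ⟨ht0.le, htc⟩
  refine ⟨γ t, htN, ?_, fun h => ?_⟩
  · have := hγ.mem_side (m := 0) (s := 1) (t := t) fun h => by
      rw [Set.uIcc_of_ge unitInterval.le_one'] at h
      exact ht0.not_ge h.1
    rwa [hγ.left, hγ.right] at this
  -- The component `side (γ t) (f (γ t))` contains `f x` but not `x`, so if it contained `u` it
  -- would join `u` to `f x` off `x`.
  · have h2 : γ t ∉ side (γ m) (f x) := fun h2 => by
      have h3 := hγ.mem_side (m := m) (s := t) (t := 0) fun h => by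
        rw [Set.uIcc_of_ge unitInterval.nonneg'] at h
        exact htm.not_ge h.2
      rw [hγ.left, ← side_eq h2] at h3
      exact hxm h3
    have h3 : f x ∈ side (γ t) (f (γ t)) :=
      mem_side_of_isPreconnected isPreconnected_side h2 htf hfx
    have h4 : x ∉ side (γ t) (f (γ t)) := fun h4 => by
      have h5 := hγ.notMem_side hJ ht0 (htm.trans hm1)
      rw [hγ.left, hγ.right] at h5
      rw [side_eq h4] at h3
      exact h5 h3
    exact hu (mem_side_of_isPreconnected isPreconnected_side h4 h3 h)

/-- If a continuous self-map of a dendrite moves `u` towards `v` and `v` towards `u`, then it has a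
fixed point between `u` and `v`. -/
theorem exists_fixedPoint_between [CompactSpace X] (hJ : ¬ ∃ g : Circle → X, IsEmbedding g)
    {f : X → X} (hf : Continuous f) {u v : X} (hu : f u ∈ side u v) (hv : f v ∈ side v u) :
    ∃ x ∈ side u v ∩ side v u, f x = x := by
  -- Points from `u` to `v` that `f` does not move towards `u`. Ordered by `u ∉ side x y`, this
  -- compact set has a maximal element by Zorn; that element is fixed, since otherwise
  -- `exists_further_point` would give a larger one.
  let T : Set X := (insert u (side u v) ∩ insert v (side v u)) ∩ {x | u ∉ side x (f x)}
  have hT : IsClosed T := (isClosed_insert_side.inter isClosed_insert_side).inter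
    (isOpen_setOf_mem_side u continuous_id hf).isClosed_compl
  have huT : u ∈ T := ⟨⟨Or.inl rfl, Or.inr (mem_side_self (ne_of_mem_side hv).1)⟩, notMem_side⟩
  obtain ⟨⟨x, hxT⟩, hmax⟩ := exists_maximal_of_chains_bounded
    (r := fun x y : T => u ∉ side (x : X) y) (fun c hc => by
      rcases c.eq_empty_or_nonempty with rfl | hne
      · exact ⟨⟨u, huT⟩, by simp⟩
      have := hne.to_subtype
      let K : c → Set X := fun w => T ∩ {z | u ∉ side (w : X) z}
      have hK : ∀ w, IsClosed (K w) := fun w =>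
        hT.inter (isOpen_setOf_mem_side u continuous_const continuous_id).isClosed_compl
      have hself : ∀ w : X, u ∉ side w w := fun w h => (ne_of_mem_side h).1 rfl
      obtain ⟨z, hz⟩ := IsCompact.nonempty_iInter_of_directed_nonempty_isCompact_isClosed K
        (fun w w' => by
          have hsub : ∀ w w' : c, u ∉ side (w : X) w' → K w' ⊆ K w := fun w w' h z hz =>
            ⟨hz.1, notMem_side_trans h hz.2⟩
          by_cases hww : w = w'
          · exact ⟨w, subset_rfl, hww ▸ subset_rfl⟩
          rcases hc w.2 w'.2 (fun h => hww (Subtype.ext h)) with h | h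
          · exact ⟨w', hsub w w' h, subset_rfl⟩
          · exact ⟨w, subset_rfl, hsub w' w h⟩)
        (fun w => ⟨w, w.1.2, hself _⟩) (fun w => (hK w).isCompact) hK
      rw [Set.mem_iInter] at hz
      exact ⟨⟨z, (hz (Classical.arbitrary c)).1⟩, fun w hw => (hz ⟨w, hw⟩).2⟩)
    (fun h h' => notMem_side_trans h h')
  have hxv : x ≠ v := by
    rintro rfl
    exact hxT.2 (mem_side_symm hv)
  have hxvu : x ∈ side v u := hxT.1.2.resolve_left hxv
  have hfix : f x = x := by
    by_contra hne
    obtain ⟨y, hyT, hyx⟩ : ∃ y ∈ T, y ∈ side x (f x) := by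
      rcases hxT.1.1 with hxu | hxu
      · obtain ⟨y, hyN, hyx, hy⟩ := exists_further_point hJ hf hxT.2 (Ne.symm hne)
          (isOpen_side.mem_nhds hxvu)
        refine ⟨y, ⟨⟨Or.inr ?_, Or.inr hyN⟩, hy⟩, hyx⟩
        rw [hxu, ← side_eq hu] at hyx
        exact hyx
      · obtain ⟨y, hyN, hyx, hy⟩ := exists_further_point hJ hf hxT.2 (Ne.symm hne)
          ((isOpen_side.inter isOpen_side).mem_nhds ⟨hxu, hxvu⟩)
        exact ⟨y, ⟨⟨Or.inr hyN.1, Or.inr hyN.2⟩, hy⟩, hyx⟩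
    have h1 : u ∉ side x y := by
      rw [← side_eq hyx]; exact hxT.2
    exact (ne_of_mem_side hyx).2 (eq_of_notMem_side h1 (hmax ⟨y, hyT⟩ h1)).symm
  refine ⟨x, ⟨hxT.1.1.resolve_left ?_, hxvu⟩, hfix⟩
  rintro rfl
  exact (ne_of_mem_side hu).2 hfix

/-- Either `f` has a periodic point at `p` or between `p` and `f p`, or the forward orbit of `p`
stays on the side of `f p`. -/
theorem periodic_or_iterate_mem_side [CompactSpace X] (hJ : ¬ ∃ g : Circle → X, IsEmbedding g)
    {f : X → X} (hf : Continuous f) {p : X} (hp : f p ≠ p) :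
    (∃ z ∈ insert p (side p (f p) ∩ side (f p) p), z ∈ Function.periodicPts f) ∨
      ∀ i, 0 < i → f^[i] p ∈ side p (f p) := by
  rw [or_iff_not_imp_left]
  intro hper i hi
  induction i, hi using Nat.le_induction with
  | base => exact mem_side_self hp
  | succ i hi ih =>
    by_contra hnot
    have hne : p ≠ f^[i + 1] p := fun h =>
      hper ⟨p, Or.inl rfl, i + 1, Nat.succ_pos i, h.symm⟩
    obtain ⟨γ, hγ⟩ := exists_isArcParam hne
    -- Every point of the arc except `p` is on the side of `f^[i + 1] p`, so `f p` is off the arc.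
    -- Hence `f^[i]` moves `f p` towards `p`, and by induction `p` towards `f p`.
    have hfp : f p ∉ Set.range γ := by
      rintro ⟨t, ht⟩
      refine hnot ?_
      have := hγ.mem_side (m := 0) (s := t) (t := 1) fun h => by
        rw [Set.uIcc_of_le unitInterval.le_one'] at h
        have h0 : t = 0 := le_antisymm h.1 unitInterval.nonneg'
        rw [h0, hγ.left] at ht
        exact hp ht.symm
      rwa [hγ.left, hγ.right, ht] at this
    have hq : f^[i] (f p) ∈ side (f p) p := mem_side_of_isPreconnected
      (isPreconnected_range hγ.embedding.continuous) hfp ⟨0, hγ.left⟩ ⟨1, hγ.right⟩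
    obtain ⟨z, hz, hfz⟩ := exists_fixedPoint_between hJ (hf.iterate i) ih hq
    exact hper ⟨z, Or.inr hz, i, hi, hfz⟩

theorem IsRecurrentPtOfArcType.mem_closure_periodicPts [CompactSpace X]
    (hJ : ¬ ∃ g : Circle → X, IsEmbedding g) {f : X → X} (hf : Continuous f) {b : X}
    (hb : IsRecurrentPtOfArcType f b) : b ∈ closure (Function.periodicPts f) := by
  obtain ⟨a, γ, hγ, n, hn, hmem, hlim⟩ := hb
  rw [mem_closure_iff]
  intro N hN hbN
  -- The condition `1 ≤ k` ensures `0 < n k`.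
  obtain ⟨k, hk, hkN, hk1⟩ := ((hlim.eventually (hγ.eventually_between_subset hJ hN hbN)).and
    ((hlim.eventually (hN.mem_nhds hbN)).and (eventually_ge_atTop 1))).exists
  replace hk := hk (hmem k)
  obtain ⟨s, hs, hsk⟩ := hmem k
  have hfar : ∀ᶠ y in 𝓝 b, y ∉ γ '' Set.Iic s := by
    refine (isClosed_Iic.isCompact.image hγ.embedding.continuous).isClosed.isOpen_compl.mem_nhds ?_
    rintro ⟨t, ht, htb⟩
    rw [← hγ.right] at htb
    exact hs.2.not_ge (hγ.embedding.injective htb ▸ ht)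
  -- A later return beyond `y` on the arc, hence strictly between `y` and `b`.
  obtain ⟨j, hj, hkj⟩ := ((hlim.eventually hfar).and (eventually_gt_atTop k)).exists
  obtain ⟨t, ht, htj⟩ := hmem j
  have hst : s < t := not_le.1 fun h => hj ⟨t, h, htj⟩
  have hnk : 0 < n k := (Nat.zero_le _).trans_lt (hn hk1)
  have hm : 0 < n j - n k := Nat.sub_pos_of_lt (hn hkj)
  set y := f^[n k] b with hy
  have hhy : f^[n j - n k] y = γ t := by
    rw [hy, ← Function.iterate_add_apply, Nat.sub_add_cancel (hn hkj).le, htj]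
  have hyb : y ≠ b := fun h => hs.2.ne (hγ.embedding.injective (by rw [hsk, h, hγ.right]))
  have hyt : γ t ≠ y := fun h => hst.ne' (hγ.embedding.injective (h.trans hsk.symm))
  have hbt : b ∈ side y (γ t) := by
    have := hγ.mem_side (m := s) (s := t) (t := 1) fun h => by
      rw [Set.uIcc_of_le unitInterval.le_one'] at h
      exact hst.not_ge h.1
    rwa [hsk, hγ.right] at this
  have hsub : side y (γ t) ∩ side (γ t) y ⊆ N := fun z hz => by
    refine hk ⟨by rw [← side_eq hbt]; exact hz.1, mem_side_of_isPreconnected isPreconnected_side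
      (fun hbz => ?_) (mem_side_self hyt.symm) hz.2⟩
    have := hγ.notMem_side hJ hst ht.2
    rw [hsk, hγ.right] at this
    exact this hbz
  rcases periodic_or_iterate_mem_side hJ (hf.iterate (n k)) (p := b) hyb with
    ⟨z, hz, hzp⟩ | hgb
  · refine ⟨z, ?_, mem_periodicPts_of_iterate hnk hzp⟩
    rcases hz with rfl | hz
    · exact hbN
    · exact hk hz.symm
  rcases periodic_or_iterate_mem_side hJ (hf.iterate (n j - n k)) (p := y)
    (by rwa [hhy]) with ⟨z, hz, hzp⟩ | hhb
  · refine ⟨z, ?_, mem_periodicPts_of_iterate hm hzp⟩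
    rw [hhy] at hz
    rcases hz with rfl | hz
    · exact hkN
    · exact hsub hz
  -- The exponent is a common multiple: this map is the `n k`-th iterate of `f^[n j - n k]` and the
  -- `(n j - n k)`-th iterate of `f^[n k]`.
  have h1 : f^[(n j - n k) * n k] y ∈ side y b := by
    rw [Function.iterate_mul, ← side_eq hbt, ← hhy]
    exact hhb _ hnk
  have h2 : f^[(n j - n k) * n k] b ∈ side b y := by
    rw [mul_comm, Function.iterate_mul]
    exact hgb _ hm
  obtain ⟨z, hz, hfz⟩ := exists_fixedPoint_between hJ (hf.iterate _) h1 h2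
  exact ⟨z, hk hz, _, Nat.mul_pos hm hnk, hfz⟩

end Dendrite

theorem theorem1p6 {X : Type*} [TopologicalSpace X] (hX : IsDendrite X)
    (f : X → X) (hf : Continuous f) (b : X) (hb : IsRecurrentPtOfArcType f b) :
    b ∈ closure (Function.periodicPts f) := by
  have := hX.metrizable
  have := hX.compact
  have := hX.connected
  have := hX.locallyConnected
  let _ := TopologicalSpace.metrizableSpaceMetric X
  have : LocallyPathConnectedSpace X := locallyPathConnectedSpace_of_compact
  have : PathConnectedSpace X := pathConnectedSpace_iff_connectedSpace.2 inferInstance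
  exact hb.mem_closure_periodicPts hX.no_jordan_curve hf
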